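/- A finite $3$-uniform hypergraph $H$ consists of a finite vertex set $V(H)$ and a set of $3$-element subsets of $V(H)$, called edges. Its chromatic number $\chi(H)$ is the least $k$ for which there is a map $V(H)\to\{1,\dots,k\}$ that is not constant on any edge, and its minimum degree $\delta(H)$ is the minimum over the vertices $v$ of the number of edges containing $v$. The chromatic threshold of a family $\mathcal F$ of finite $3$-uniform hypergraphs is the infimum of the real numbers $c\ge 0$ such that the hypergraphs $H\in\mathcal F$ with $\delta(H)\ge c\binom{|V(H)|}{2}$ have bounded chromatic number. Let $T_5$ be the $3$-uniform hypergraph with vertices $A,B,C,D,E$ and edges $\{A,B,C\}$, $\{A,D,E\}$, $\{B,D,E\}$, $\{C,D,E\}$. A $3$-uniform hypergraph $H$ is $T_5$-free if there is no injection from $V(T_5)$ to $V(H)$ that maps every edge of $T_5$ to an edge of $H$. **Proposition.** The chromatic threshold of the family of $T_5$-free $3$-uniform hypergraphs is at least $\frac{16}{49}$. -/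

import Mathlib

namespace Hypergraph

/-- `H` is `k`-colorable: there is a map from the vertices to `k` colors under
which every edge has two vertices of different colors. -/
def Colorable {α : Type*} (H : Hypergraph α) (k : ℕ) : Prop :=
  ∃ f : H.vertexSet → Fin k,
    ∀ e ∈ H.edgeSet, ∃ u v : H.vertexSet, (u : α) ∈ e ∧ (v : α) ∈ e ∧ f u ≠ f v

/-- The chromatic number: the least `k` such that `H` is `k`-colorable (`⊤` if there is none). -/
noncomputable def chromaticNumber {α : Type*} (H : Hypergraph α) : ℕ∞ :=
  ⨅ k ∈ {k : ℕ | H.Colorable k}, (k : ℕ∞)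

/-- The degree of `v`: the number of edges that contain `v`. -/
noncomputable def degree {α : Type*} (H : Hypergraph α) (v : α) : ℕ :=
  {e ∈ H.edgeSet | v ∈ e}.ncard

/-- The minimum degree (`0` if there are no vertices). -/
noncomputable def minDegree {α : Type*} (H : Hypergraph α) : ℕ :=
  ⨅ v : H.vertexSet, H.degree (v : α)

/-- `F` is a (not necessarily induced) subhypergraph of `H`: there is an injection of the vertex
set of `F` into that of `H` that maps every edge of `F` to an edge of `H`. -/
def IsSubhypergraphOf {α β : Type*} (F : Hypergraph α) (H : Hypergraph β) : Prop :=
  ∃ f : α → β, Set.MapsTo f F.vertexSet H.vertexSet ∧ Set.InjOn f F.vertexSet ∧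
    ∀ e ∈ F.edgeSet, f '' e ∈ H.edgeSet

/-- The `3`-uniform hypergraph `T₅` on five vertices `A, B, C, D, E` (here `0, 1, 2, 3, 4`) with
edges `ABC`, `ADE`, `BDE`, `CDE`. -/
def T5 : Hypergraph (Fin 5) where
  vertexSet := Set.univ
  edgeSet := {{0, 1, 2}, {0, 3, 4}, {1, 3, 4}, {2, 3, 4}}
  subset_vertexSet_of_mem_edgeSet' := fun _ _ => Set.subset_univ _

end Hypergraph

/-- A finite `r`-uniform hypergraph. -/
structure UniformHypergraph (r : ℕ) where
  /-- The ambient type of the vertices -/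
  carrier : Type
  /-- The underlying hypergraph -/
  graph : Hypergraph carrier
  /-- There are finitely many vertices -/
  finite_vertexSet : graph.vertexSet.Finite
  /-- Every edge has exactly `r` vertices -/
  encard_edge : ∀ e ∈ graph.edgeSet, e.encard = r

/-- The chromatic threshold of a family `𝓕` of `r`-uniform hypergraphs: the infimum of the `c ≥ 0`
such that the members `H` of `𝓕` with minimum degree at least `c * (|V(H)| choose (r - 1))` have
bounded chromatic number. -/
noncomputable def chromaticThreshold {r : ℕ} (𝓕 : Set (UniformHypergraph r)) : ℝ :=
  sInf {c : ℝ | 0 ≤ c ∧ ∃ M : ℕ, ∀ H ∈ 𝓕,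
    c * (H.graph.vertexSet.ncard.choose (r - 1) : ℝ) ≤ (H.graph.minDegree : ℝ) →
      H.graph.chromaticNumber ≤ (M : ℕ∞)}

/-- The family of `A`-free `r`-uniform hypergraphs. -/
def freeFamily {α : Type*} (A : Hypergraph α) (r : ℕ) : Set (UniformHypergraph r) :=
  {H | ¬ A.IsSubhypergraphOf H.graph}

/-! Fix q ≥ 1 and k = 3q + 1. The core is the shift hypergraph: increasing k-tuples from n points,
with three consecutive windows of a (k + 2)-tuple as edges. It is T₅-free, and its chromatic number
is unbounded as n grows. To each tuple u attach the set S(u) of permutations of the n points whose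
maximum over u sits at a position not divisible by 3. S(u) has density 2q/(3q + 1), close to 2/3,
yet the three sets of an edge have no common element.

Add X, made of copies of the set of permutations, and Y, with |X| : |Y| = 4 : 3. The new edges are
all XXY triples and the triples uxy with x over S(u). Emptiness of the triple intersections keeps
the extension T₅-free (`extAdj_T5_free`), and the core keeps its chromatic number large. With |X| =
4T and |Y| = 3T, degrees are about (2/3)·12T² = 8T² in the core, 12T² in X and 8T² in Y. The ratio 4
: 3 balances the first and the last. Since the core has fixed size, the density tends to 8/(49/2) =
16/49. -/

theorem set_triple_eq {α : Type*} {a b c x y z : α} (hab : a ≠ b) (hac : a ≠ c) (hbc : b ≠ c)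
    (h : ({a, b, c} : Set α) = {x, y, z}) :
    (a = x ∧ b = y ∧ c = z) ∨ (a = x ∧ b = z ∧ c = y) ∨ (a = y ∧ b = x ∧ c = z) ∨
    (a = y ∧ b = z ∧ c = x) ∨ (a = z ∧ b = x ∧ c = y) ∨ (a = z ∧ b = y ∧ c = x) := by
  have ha : a ∈ ({x, y, z} : Set α) := h ▸ by simp
  have hb : b ∈ ({x, y, z} : Set α) := h ▸ by simp
  have hc : c ∈ ({x, y, z} : Set α) := h ▸ by simp
  simp only [Set.mem_insert_iff, Set.mem_singleton_iff] at ha hb hc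
  grind

/-- Strictly increasing `k`-tuples with entries in `Fin n`. -/
abbrev IncTuple (k n : ℕ) := {v : Fin k → Fin n // StrictMono v}

/-! ### The shift hypergraph and its sets of permutations -/

namespace IncTuple

/-- The window of length `k` that starts at position `j`. -/
def window {k l n : ℕ} (x : IncTuple l n) (j : ℕ) (h : k + j ≤ l) : IncTuple k n :=
  ⟨fun i => x.1 ⟨i + j, by omega⟩, fun a b hab => x.2 (by
    simp only [Fin.lt_def] at hab ⊢; omega)⟩

/-- `c` is a proper coloring of the shift graph on increasing `k`-tuples. -/
def IsShiftColoring {k n : ℕ} {C : Type} (c : IncTuple k n → C) : Prop :=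
  ∀ x : IncTuple (k + 1) n, c (x.window 0 (by omega)) ≠ c (x.window 1 (by omega))

/-- Shortening the tuples by one costs an exponential in the number of colors: color y by the set of
colors of its extensions to the right. If both windows of x had the same set, some w prolonging x by
one entry would have the color of x. -/
theorem IsShiftColoring.reduce {k n : ℕ} {C : Type} {c : IncTuple (k + 2) n → C}
    (hc : IsShiftColoring c) :
    IsShiftColoring (fun y : IncTuple (k + 1) n =>
      {a : C | ∃ w : IncTuple (k + 2) n, w.window 0 (by omega) = y ∧ c w = a}) := by
  intro x hx
  have h : c x ∈ {a : C | ∃ w : IncTuple (k + 2) n,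
      w.window 0 (by omega) = x.window (k := k + 1) 1 (by omega) ∧ c w = a} := by
    exact (Set.ext_iff.1 hx (c x)).1 ⟨x, rfl, rfl⟩
  obtain ⟨w, hw, hcw⟩ := h
  have hw' : ∀ i (hi : i < k + 1), w.1 ⟨i, by omega⟩ = x.1 ⟨i + 1, by omega⟩ := fun i hi =>
    congrFun (congrArg Subtype.val hw) ⟨i, hi⟩
  let z : IncTuple (k + 3) n := ⟨fun i =>
      if hi : i.1 < k + 2 then x.1 ⟨i, hi⟩ else w.1 ⟨k + 1, by omega⟩, by
    refine Fin.strictMono_iff_lt_succ.2 fun i => ?_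
    have hi := i.2
    simp only [Fin.val_castSucc, Fin.val_succ]
    rw [dif_pos hi]
    split_ifs with h1
    · exact x.2 (by simp [Fin.lt_def])
    · have : i.1 = k + 1 := by omega
      have h2 := hw' k (by omega)
      have h3 : (⟨i.1, hi⟩ : Fin (k + 2)) = ⟨k + 1, by omega⟩ := by simp [this]
      rw [h3, ← h2]
      exact w.2 (by simp [Fin.lt_def])⟩
  have h0 : z.window (k := k + 2) 0 (by omega) = x := by
    ext i
    simp [z, window]
  have h1 : z.window (k := k + 2) 1 (by omega) = w := by
    ext i
    simp only [z, window]
    split_ifs with h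
    · rw [← hw' i.1 (by omega)]
    · have : i = ⟨k + 1, by omega⟩ := by ext; simp; omega
      rw [this]
  exact hc z (by rw [h0, h1, hcw])

theorem exists_no_shiftColoring (k : ℕ) : ∀ (C : Type) [Finite C],
    ∃ n : ℕ, ∀ c : IncTuple (k + 1) n → C, ¬ IsShiftColoring c := by
  induction k with
  | zero =>
    intro C _
    have : Subsingleton (Fin (0 + 1)) := inferInstanceAs (Subsingleton (Fin 1))
    refine ⟨Nat.card C + 1, fun c hc => ?_⟩
    -- The shift graph on 1-tuples is complete, so a proper coloring is injective.
    have hinj : Function.Injective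
        (fun a : Fin (Nat.card C + 1) => c ⟨fun _ : Fin 1 => a, Subsingleton.strictMono _⟩) := by
      refine Function.Injective.of_lt_imp_ne fun a b hab h => ?_
      refine hc ⟨![a, b], by simpa [Fin.strictMono_iff_lt_succ] using hab⟩ ?_
      convert h using 2
      · ext i; simp [window, Subsingleton.elim i 0]
      · ext i; simp [window, Subsingleton.elim i 0]
    have := Nat.card_le_card_of_injective _ hinj
    simp at this
  | succ k ih =>
    intro C _
    obtain ⟨n, hn⟩ := ih (Set C)
    exact ⟨n, fun c hc => hn _ hc.reduce⟩

/-- The edges of the shift hypergraph: three consecutive windows of an increasing tuple. -/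
def ShiftEdge {k n : ℕ} (u v w : IncTuple k n) : Prop :=
  ∃ x : IncTuple (k + 2) n, ({u, v, w} : Set (IncTuple k n)) =
    {x.window 0 (by omega), x.window 1 (by omega), x.window 2 (by omega)}

/-- The shift hypergraph has unbounded chromatic number. -/
theorem exists_shiftEdge_monochromatic (k M : ℕ) : ∃ n : ℕ, ∀ c : IncTuple k n → Fin M,
    ∃ u v w, ShiftEdge u v w ∧ c u = c v ∧ c v = c w := by
  obtain ⟨n, hn⟩ := exists_no_shiftColoring k (Fin M × Fin M)
  refine ⟨n, fun c => ?_⟩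
  -- If this coloring by pairs gives the two windows of a (k + 2)-tuple the same pair, its three
  -- windows of length k share one color.
  have h := hn fun x => (c (x.window 0 (by omega)), c (x.window 1 (by omega)))
  simp only [IsShiftColoring, ne_eq, not_forall, not_not, Prod.mk.injEq] at h
  obtain ⟨x, h1, h2⟩ := h
  exact ⟨x.window 0 (by omega), x.window 1 (by omega), x.window 2 (by omega), ⟨x, rfl⟩, h1, h2⟩

theorem window_ne {k l n : ℕ} (hk : 0 < k) (x : IncTuple l n) {i j : ℕ} (hi : k + i ≤ l)
    (hj : k + j ≤ l) (hij : i ≠ j) : x.window i hi ≠ x.window j hj := by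
  intro h
  have := x.2.injective (congrFun (congrArg Subtype.val h) ⟨0, hk⟩)
  simp only [Fin.mk.injEq] at this
  omega

theorem ShiftEdge.ne {k n : ℕ} (hk : 0 < k) {u v w : IncTuple k n} (h : ShiftEdge u v w) :
    u ≠ v ∧ u ≠ w ∧ v ≠ w := by
  obtain ⟨x, hx⟩ := h
  have h01 := window_ne hk x (i := 0) (j := 1) (by omega) (by omega) (by omega)
  have h02 := window_ne hk x (i := 0) (j := 2) (by omega) (by omega) (by omega)
  have h12 := window_ne hk x (i := 1) (j := 2) (by omega) (by omega) (by omega)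
  have := set_triple_eq h01 h02 h12 hx.symm
  grind

/-- In an edge `Y, D, E` of the shift hypergraph, the entries of `Y` are determined by those of
`D` and `E`, up to the position of `Y`. -/
theorem ShiftEdge.entries {k n : ℕ} {Y D E : IncTuple (k + 3) n} (h : ShiftEdge Y D E)
    (hYD : Y ≠ D) (hYE : Y ≠ E) (hlt : D.1 0 < E.1 0) :
    (Y.1 0 = D.1 1 ∧ E.1 0 = D.1 2) ∨ (Y.1 2 = D.1 1 ∧ E.1 0 = D.1 1) ∨
      (Y.1 0 = D.1 2 ∧ E.1 0 = D.1 1) := by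
  have hDE : D ≠ E := by rintro rfl; exact lt_irrefl _ hlt
  obtain ⟨x, hx⟩ := h
  have e : 2 % (k + 3) = 2 := Nat.mod_eq_of_lt (by omega)
  rcases set_triple_eq hYD hYE hDE hx with ⟨rfl, rfl, rfl⟩ | ⟨rfl, rfl, rfl⟩ | ⟨rfl, rfl, rfl⟩ |
      ⟨rfl, rfl, rfl⟩ | ⟨rfl, rfl, rfl⟩ | ⟨rfl, rfl, rfl⟩ <;>
    simp [window, x.2.lt_iff_lt, x.2.injective.eq_iff, e] at hlt ⊢

/-- The tuples of an edge of the shift hypergraph have different entries in every position. -/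
theorem ShiftEdge.entries_ne {k n : ℕ} {A B C : IncTuple k n} (h : ShiftEdge A B C)
    (hAB : A ≠ B) (hAC : A ≠ C) (hBC : B ≠ C) (i : Fin k) :
    A.1 i ≠ B.1 i ∧ A.1 i ≠ C.1 i ∧ B.1 i ≠ C.1 i := by
  obtain ⟨x, hx⟩ := h
  rcases set_triple_eq hAB hAC hBC hx with ⟨rfl, rfl, rfl⟩ | ⟨rfl, rfl, rfl⟩ | ⟨rfl, rfl, rfl⟩ |
      ⟨rfl, rfl, rfl⟩ | ⟨rfl, rfl, rfl⟩ | ⟨rfl, rfl, rfl⟩ <;>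
    simp [window, x.2.injective.eq_iff]

/-- The shift hypergraph is `T₅`-free. -/
theorem shiftEdge_T5_free {k n : ℕ} {A B C D E : IncTuple (k + 3) n}
    (hAB : A ≠ B) (hAC : A ≠ C) (hBC : B ≠ C) (hAD : A ≠ D) (hAE : A ≠ E) (hBD : B ≠ D)
    (hBE : B ≠ E) (hCD : C ≠ D) (hCE : C ≠ E) (hDE : D ≠ E) (h : ShiftEdge A B C)
    (h1 : ShiftEdge A D E) (h2 : ShiftEdge B D E) (h3 : ShiftEdge C D E) : False := by
  wlog hlt : D.1 0 < E.1 0 generalizing D E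
  · have hne := (h1.entries_ne hAD hAE hDE 0).2.2
    have hsymm : ∀ {X : IncTuple (k + 3) n}, ShiftEdge X D E → ShiftEdge X E D := by
      rintro X ⟨x, hx⟩
      exact ⟨x, by rw [← hx, Set.pair_comm]⟩
    exact this hAE hAD hBE hBD hCE hCD hDE.symm (hsymm h1) (hsymm h2) (hsymm h3)
      (lt_of_le_of_ne (not_lt.1 hlt) hne.symm)
  have a1 := h1.entries hAD hAE hlt
  have a2 := h2.entries hBD hBE hlt
  have a3 := h3.entries hCD hCE hlt
  have b0 := h.entries_ne hAB hAC hBC 0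
  have b2 := h.entries_ne hAB hAC hBC 2
  have hD : D.1 1 ≠ D.1 2 := by
    have e : 2 % (k + 3) = 2 := Nat.mod_eq_of_lt (by omega)
    simp [D.2.injective.eq_iff, Fin.ext_iff, e]
  -- If E₀ = D₂, then A, B, C all have first entry D₁. If E₀ = D₁, each has third entry D₁ or first
  -- entry D₂, so two of them agree at a position.
  grind

/-- The permutations `ω` for which the largest of the values of `ω` on the entries of `v` occurs
at a position that is not divisible by three. -/
def argmaxSet {k n : ℕ} (v : IncTuple k n) : Set (Equiv.Perm (Fin n)) :=
  {ω | ∃ p : Fin k, p.1 % 3 ≠ 0 ∧ ∀ i, ω (v.1 i) ≤ ω (v.1 p)}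

/-- The first and last positions, 0 and 3q, are divisible by 3, so each maximum also lies in the
neighboring windows. All three maxima are then the same entry of x, at positions a, a - 1, a - 2,
one of which is divisible by 3. -/
theorem argmaxSet_window_inter {q n : ℕ} (x : IncTuple (3 * q + 1 + 2) n)
    (ω : Equiv.Perm (Fin n)) (h0 : ω ∈ argmaxSet (x.window (k := 3 * q + 1) 0 (by omega)))
    (h1 : ω ∈ argmaxSet (x.window (k := 3 * q + 1) 1 (by omega)))
    (h2 : ω ∈ argmaxSet (x.window (k := 3 * q + 1) 2 (by omega))) : False := by
  obtain ⟨⟨a, ha⟩, ha3, hamax⟩ := h0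
  obtain ⟨⟨b, hb⟩, hb3, hbmax⟩ := h1
  obtain ⟨⟨c, hc⟩, hc3, hcmax⟩ := h2
  simp only [window] at ha3 hb3 hc3 hamax hbmax hcmax
  have key : ∀ {i j : ℕ} (hi : i < 3 * q + 1 + 2) (hj : j < 3 * q + 1 + 2),
      ω (x.1 ⟨i, hi⟩) ≤ ω (x.1 ⟨j, hj⟩) → ω (x.1 ⟨j, hj⟩) ≤ ω (x.1 ⟨i, hi⟩) → i = j := by
    intro i j hi hj h h'
    simpa using x.2.injective (ω.injective (le_antisymm h h'))
  have e1 : a + 0 = b + 1 := by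
    refine key (by omega) (by omega) ?_ (hamax ⟨b + 1, by omega⟩)
    have := hbmax ⟨a - 1, by omega⟩
    simpa [show a - 1 + 1 = a by omega] using this
  have e2 : b + 1 = c + 2 := by
    refine key (by omega) (by omega) ?_ (hbmax ⟨c + 1, by omega⟩)
    have := hcmax ⟨b - 1, by omega⟩
    simpa [show b - 1 + 2 = b + 1 by omega] using this
  omega

theorem ShiftEdge.argmaxSet_inter {q n : ℕ} {u v w : IncTuple (3 * q + 1) n}
    (h : ShiftEdge u v w) (ω : Equiv.Perm (Fin n)) (hu : ω ∈ argmaxSet u) (hv : ω ∈ argmaxSet v)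
    (hw : ω ∈ argmaxSet w) : False := by
  obtain ⟨x, hx⟩ := h
  have hall : ∀ y ∈ ({u, v, w} : Set (IncTuple (3 * q + 1) n)), ω ∈ argmaxSet y := by
    rintro y (rfl | rfl | rfl) <;> assumption
  rw [hx] at hall
  exact argmaxSet_window_inter x ω (hall _ (by simp)) (hall _ (by simp)) (hall _ (by simp))

theorem card_filter_mod_three (q : ℕ) :
    (Finset.univ.filter fun p : Fin (3 * q + 1) => p.1 % 3 ≠ 0).card = 2 * q := by
  rw [Finset.card_filter, Fin.sum_univ_eq_sum_range (fun i => if i % 3 ≠ 0 then 1 else 0)]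
  induction q with
  | zero => simp
  | succ q ih =>
    rw [show 3 * (q + 1) + 1 = 3 * q + 1 + 1 + 1 + 1 by ring, Finset.sum_range_succ,
      Finset.sum_range_succ, Finset.sum_range_succ, ih]
    rw [if_pos (by omega), if_pos (by omega), if_neg (by omega)]
    ring

-- By symmetry the maximum is equally likely at each of the 3q + 1 positions, of which 2q are
-- allowed.
open Classical in
theorem card_argmaxSet {q n : ℕ} (v : IncTuple (3 * q + 1) n) :
    (3 * q + 1) * (argmaxSet v).ncard = 2 * q * Fintype.card (Equiv.Perm (Fin n)) := by
  let F : Fin (3 * q + 1) → Finset (Equiv.Perm (Fin n)) := fun p =>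
    Finset.univ.filter fun ω => ∀ i, ω (v.1 i) ≤ ω (v.1 p)
  have hF : ∀ p ω, ω ∈ F p ↔ ∀ i, ω (v.1 i) ≤ ω (v.1 p) := fun p ω => by simp [F]
  have hdisj : ∀ s : Set (Fin (3 * q + 1)), s.PairwiseDisjoint F := by
    intro s p _ r _ hpr
    refine Finset.disjoint_left.2 fun ω hp hr => hpr ?_
    exact v.2.injective (ω.injective (le_antisymm ((hF r ω).1 hr p) ((hF p ω).1 hp r)))
  have hle : ∀ p r, (F p).card ≤ (F r).card := by
    intro p r
    -- Composing with the transposition of two entries moves the maximum from one to the other.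
    refine Finset.card_le_card_of_injOn (fun ω => ω * Equiv.swap (v.1 p) (v.1 r)) ?_
      fun a _ b _ h => mul_right_cancel h
    intro ω hω
    have hω' := (hF p ω).1 hω
    refine (hF r _).2 fun i => ?_
    simp only [Equiv.Perm.mul_apply, Equiv.swap_apply_right]
    rcases eq_or_ne i p with rfl | hip
    · simpa using hω' r
    rcases eq_or_ne i r with rfl | hir
    · simp
    · rw [Equiv.swap_apply_of_ne_of_ne (v.2.injective.ne hip) (v.2.injective.ne hir)]
      exact hω' i
  have hcard : ∀ p, (F p).card = (F 0).card := fun p => le_antisymm (hle _ _) (hle _ _)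
  have huniv : Finset.univ.biUnion F = Finset.univ := by
    refine Finset.eq_univ_of_forall fun ω => ?_
    obtain ⟨p, hp⟩ := Finite.exists_max fun i => ω (v.1 i)
    exact Finset.mem_biUnion.2 ⟨p, Finset.mem_univ _, (hF p ω).2 hp⟩
  have hS : argmaxSet v =
      ((Finset.univ.filter fun p : Fin (3 * q + 1) => p.1 % 3 ≠ 0).biUnion F : Finset _) := by
    ext ω
    simp [argmaxSet, hF]
  have h1 : (Finset.univ.biUnion F).card = (3 * q + 1) * (F 0).card := by
    rw [Finset.card_biUnion (by simpa using hdisj Set.univ),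
      Finset.sum_congr rfl fun p _ => hcard p]
    simp
  rw [hS, Set.ncard_coe_finset,
    Finset.card_biUnion fun p _ r _ h => hdisj Set.univ trivial trivial h,
    Finset.sum_congr rfl fun p _ => hcard p, Finset.sum_const, card_filter_mod_three,
    ← Finset.card_univ, ← huniv, h1]
  simp only [smul_eq_mul]
  ring

end IncTuple

/-! ### The extension of a core: T₅-freeness, coloring and degrees -/

namespace Hypergraph

theorem colorable_of_chromaticNumber_le {α : Type*} {H : Hypergraph α} {M : ℕ}
    (h : H.chromaticNumber ≤ M) : H.Colorable M := by
  have hlt : H.chromaticNumber < ((M + 1 : ℕ) : ℕ∞) :=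
    lt_of_le_of_lt h (by exact_mod_cast Nat.lt_succ_self M)
  simp only [chromaticNumber, iInf_lt_iff, Set.mem_ofPred_eq] at hlt
  obtain ⟨j, ⟨f, hf⟩, hj⟩ := hlt
  have hj' : j ≤ M := by
    have : j < M + 1 := by exact_mod_cast hj
    omega
  refine ⟨fun v => Fin.castLE hj' (f v), fun e he => ?_⟩
  obtain ⟨u, v, hu, hv, huv⟩ := hf e he
  exact ⟨u, v, hu, hv, by simpa [Fin.ext_iff] using huv⟩

theorem Colorable.chromaticNumber_le {α : Type*} {H : Hypergraph α} {M : ℕ}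
    (h : H.Colorable M) : H.chromaticNumber ≤ M :=
  iInf₂_le M h

section Extension

variable {K Ω : Type} (KE : K → K → K → Prop) (S : K → Set Ω) (s r : ℕ)

/-- The vertices of `extension`: those of the core, `s` copies of `Ω`, and `r` further vertices. -/
abbrev ExtVertex (K Ω : Type) (s r : ℕ) := K ⊕ (Ω × Fin s) ⊕ Fin r

variable {s r}

/-- The edge relation of `extension`. -/
def ExtAdj : ExtVertex K Ω s r → ExtVertex K Ω s r → ExtVertex K Ω s r → Prop
  | .inl u, .inl v, .inl w => u ≠ v ∧ u ≠ w ∧ v ≠ w ∧ KE u v w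
  | .inl u, .inr (.inl a), .inr (.inr _) => a.1 ∈ S u
  | .inl u, .inr (.inr _), .inr (.inl a) => a.1 ∈ S u
  | .inr (.inl a), .inl u, .inr (.inr _) => a.1 ∈ S u
  | .inr (.inr _), .inl u, .inr (.inl a) => a.1 ∈ S u
  | .inr (.inl a), .inr (.inr _), .inl u => a.1 ∈ S u
  | .inr (.inr _), .inr (.inl a), .inl u => a.1 ∈ S u
  | .inr (.inl a), .inr (.inl a'), .inr (.inr _) => a ≠ a'
  | .inr (.inl a), .inr (.inr _), .inr (.inl a') => a ≠ a'
  | .inr (.inr _), .inr (.inl a), .inr (.inl a') => a ≠ a'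
  | _, _, _ => False

variable {KE S}

theorem ExtAdj.ne {x y z : ExtVertex K Ω s r} (h : ExtAdj KE S x y z) :
    x ≠ y ∧ x ≠ z ∧ y ≠ z := by
  rcases x with u | a | b <;> rcases y with u' | a' | b' <;> rcases z with u'' | a'' | b'' <;>
    simp only [ExtAdj] at h <;> simp <;> tauto

theorem ExtAdj.swap_left (hKE : ∀ u v w, KE u v w → KE v u w) {x y z : ExtVertex K Ω s r}
    (h : ExtAdj KE S x y z) : ExtAdj KE S y x z := by
  rcases x with u | a | b <;> rcases y with u' | a' | b' <;> rcases z with u'' | a'' | b'' <;>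
    simp only [ExtAdj] at h ⊢ <;> first | exact h | exact h.symm | skip
  exact ⟨h.1.symm, h.2.2.1, h.2.1, hKE _ _ _ h.2.2.2⟩

theorem ExtAdj.swap_right (hKE : ∀ u v w, KE u v w → KE u w v) {x y z : ExtVertex K Ω s r}
    (h : ExtAdj KE S x y z) : ExtAdj KE S x z y := by
  rcases x with u | a | b <;> rcases y with u' | a' | b' <;> rcases z with u'' | a'' | b'' <;>
    simp only [ExtAdj] at h ⊢ <;> first | exact h | exact h.symm | skip
  exact ⟨h.2.1, h.1, h.2.2.1.symm, hKE _ _ _ h.2.2.2⟩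

variable (KE S s r) in
/-- The extension of a core hypergraph on `K` by `s` copies of `Ω` and `r` further vertices:
two vertices of the first kind and one of the second form an edge, and a vertex `u` of the core
forms edges with the pairs of vertices, one of each kind, whose projection to `Ω` is in `S u`. -/
def extension : Hypergraph (ExtVertex K Ω s r) where
  vertexSet := Set.univ
  edgeSet := {e | ∃ x y z, e = {x, y, z} ∧ ExtAdj KE S x y z}
  subset_vertexSet_of_mem_edgeSet' := fun _ _ => Set.subset_univ _

theorem extAdj_of_mem_edgeSet (hl : ∀ u v w, KE u v w → KE v u w)
    (hr : ∀ u v w, KE u v w → KE u w v) {a b c : ExtVertex K Ω s r} (hab : a ≠ b) (hac : a ≠ c)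
    (hbc : b ≠ c) (h : {a, b, c} ∈ (extension KE S s r).edgeSet) : ExtAdj KE S a b c := by
  obtain ⟨x, y, z, he, h⟩ := h
  rcases set_triple_eq hab hac hbc he with ⟨rfl, rfl, rfl⟩ | ⟨rfl, rfl, rfl⟩ |
    ⟨rfl, rfl, rfl⟩ | ⟨rfl, rfl, rfl⟩ | ⟨rfl, rfl, rfl⟩ | ⟨rfl, rfl, rfl⟩
  · exact h
  · exact h.swap_right hr
  · exact h.swap_left hl
  · exact (h.swap_left hl).swap_right hr
  · exact (h.swap_right hr).swap_left hl
  · exact ((h.swap_left hl).swap_right hr).swap_left hl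

/-- The types of D and E restrict those of A, B, C. Two core vertices D, E force a T₅ in the core.
One of D, E in X and the other in Y puts A, B, C in the core or X, where only core triples are
edges; the X-vertex then projects into all three sets. In all other cases A, B, C would lie wholly
in X or in Y, or could not exist. -/
theorem extAdj_T5_free
    (hS : ∀ u v w, KE u v w → ∀ ω, ω ∈ S u → ω ∈ S v → ω ∈ S w → False)
    (hT5 : ∀ A B C D E : K, [A, B, C, D, E].Nodup → KE A B C → KE A D E → KE B D E →
      KE C D E → False)
    {A B C D E : ExtVertex K Ω s r} (h : ExtAdj KE S A B C)
    (h1 : ExtAdj KE S A D E) (h2 : ExtAdj KE S B D E) (h3 : ExtAdj KE S C D E) : False := by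
  rcases D with D | D | D <;> rcases E with E | E | E <;> rcases A with A | A | A <;>
    simp only [ExtAdj] at h1 <;> rcases B with B | B | B <;> simp only [ExtAdj] at h2 <;>
    rcases C with C | C | C <;> simp only [ExtAdj] at h3 <;> simp only [ExtAdj] at h
  · refine hT5 A B C D E ?_ h.2.2.2 h1.2.2.2 h2.2.2.2 h3.2.2.2
    simp
    tauto
  · exact hS _ _ _ h.2.2.2 _ h1 h2 h3
  · exact hS _ _ _ h.2.2.2 _ h1 h2 h3

theorem extension_T5_free (hl : ∀ u v w, KE u v w → KE v u w)
    (hr : ∀ u v w, KE u v w → KE u w v)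
    (hS : ∀ u v w, KE u v w → ∀ ω, ω ∈ S u → ω ∈ S v → ω ∈ S w → False)
    (hT5 : ∀ A B C D E : K, [A, B, C, D, E].Nodup → KE A B C → KE A D E → KE B D E →
      KE C D E → False) :
    ¬ T5.IsSubhypergraphOf (extension KE S s r) := by
  rintro ⟨f, -, hf, he⟩
  have hne : ∀ i j : Fin 5, i ≠ j → f i ≠ f j := fun i j hij h =>
    hij (hf (Set.mem_univ i) (Set.mem_univ j) h)
  have key : ∀ i j l : Fin 5, i ≠ j → i ≠ l → j ≠ l → {i, j, l} ∈ T5.edgeSet →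
      ExtAdj KE S (f i) (f j) (f l) := by
    intro i j l hij hil hjl h
    refine extAdj_of_mem_edgeSet hl hr (hne _ _ hij) (hne _ _ hil) (hne _ _ hjl) ?_
    simpa [Set.image_insert_eq] using he _ h
  exact extAdj_T5_free hS hT5
    (key 0 1 2 (by decide) (by decide) (by decide) (by simp [T5]))
    (key 0 3 4 (by decide) (by decide) (by decide) (by simp [T5]))
    (key 1 3 4 (by decide) (by decide) (by decide) (by simp [T5]))
    (key 2 3 4 (by decide) (by decide) (by decide) (by simp [T5]))

theorem encard_extension_edge {e : Set (ExtVertex K Ω s r)}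
    (he : e ∈ (extension KE S s r).edgeSet) : e.encard = 3 := by
  obtain ⟨x, y, z, rfl, h⟩ := he
  exact Set.encard_eq_three.2 ⟨x, y, z, h.ne.1, h.ne.2.1, h.ne.2.2, rfl⟩

/-- A coloring of the extension colors the core. -/
theorem not_colorable_extension {M : ℕ}
    (h : ∀ c : K → Fin M, ∃ u v w, u ≠ v ∧ u ≠ w ∧ v ≠ w ∧ KE u v w ∧ c u = c v ∧ c v = c w) :
    ¬ (extension KE S s r).Colorable M := by
  rintro ⟨f, hf⟩
  obtain ⟨u, v, w, huv, huw, hvw, he, h1, h2⟩ := h fun u => f ⟨.inl u, Set.mem_univ _⟩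
  have hall : ∀ y : (extension KE S s r).vertexSet, (y : ExtVertex K Ω s r) ∈
      ({.inl u, .inl v, .inl w} : Set (ExtVertex K Ω s r)) → f y = f ⟨.inl u, Set.mem_univ _⟩ := by
    rintro ⟨y, hy⟩ hy'
    simp only [Set.mem_insert_iff, Set.mem_singleton_iff] at hy'
    rcases hy' with rfl | rfl | rfl
    · rfl
    · exact h1.symm
    · exact (h1.trans h2).symm
  obtain ⟨a, b, ha, hb, hab⟩ :=
    hf {.inl u, .inl v, .inl w} ⟨.inl u, .inl v, .inl w, rfl, huv, huw, hvw, he⟩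
  exact hab ((hall a ha).trans (hall b hb).symm)

theorem card_le_degree {α β : Type*} [Finite α] (H : Hypergraph α) (v : α) (F : Set β)
    (g : β → Set α) (hg : Set.InjOn g F) (he : ∀ b ∈ F, g b ∈ H.edgeSet ∧ v ∈ g b) :
    F.ncard ≤ H.degree v :=
  Set.ncard_le_ncard_of_injOn g (fun b hb => he b hb) hg (Set.toFinite _)

variable [Fintype K] [Fintype Ω]

theorem degree_extension_core (u : K) :
    (S u).ncard * s * r ≤ (extension KE S s r).degree (.inl u) := by
  let F : Set ((Ω × Fin s) × Fin r) := (S u ×ˢ Set.univ) ×ˢ Set.univ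
  have hF : F.ncard = (S u).ncard * s * r := by
    simp [F, Set.ncard_prod, Set.ncard_univ]
  rw [← hF]
  refine card_le_degree _ _ F (fun p => {.inl u, .inr (.inl p.1), .inr (.inr p.2)}) ?_ ?_
  · rintro ⟨a, b⟩ - ⟨a', b'⟩ - h
    have h1 := (Set.ext_iff.1 h (.inr (.inl a) : ExtVertex K Ω s r)).1 (by simp)
    have h2 := (Set.ext_iff.1 h (.inr (.inr b) : ExtVertex K Ω s r)).1 (by simp)
    simp at h1 h2
    rw [h1, h2]
  · rintro ⟨a, b⟩ ⟨⟨ha, -⟩, -⟩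
    exact ⟨⟨_, _, _, rfl, ha⟩, by simp⟩

theorem degree_extension_left (a : Ω × Fin s) :
    (Fintype.card Ω * s - 1) * r ≤ (extension KE S s r).degree (.inr (.inl a)) := by
  let F : Set ((Ω × Fin s) × Fin r) := {a}ᶜ ×ˢ Set.univ
  have hF : F.ncard = (Fintype.card Ω * s - 1) * r := by
    have h := Set.ncard_add_ncard_compl {a}
    simp only [Set.ncard_singleton, Nat.card_eq_fintype_card, Fintype.card_prod,
      Fintype.card_fin] at h
    simp [F, Set.ncard_prod, Set.ncard_univ, ← h]
  rw [← hF]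
  refine card_le_degree _ _ F
    (fun p => {.inr (.inl a), .inr (.inl p.1), .inr (.inr p.2)}) ?_ ?_
  · rintro ⟨c, b⟩ ⟨hc, -⟩ ⟨c', b'⟩ - h
    have h1 := (Set.ext_iff.1 h (.inr (.inl c) : ExtVertex K Ω s r)).1 (by simp)
    have h2 := (Set.ext_iff.1 h (.inr (.inr b) : ExtVertex K Ω s r)).1 (by simp)
    have hc' : c ≠ a := hc
    simp [hc'] at h1 h2
    rw [h1, h2]
  · rintro ⟨c, b⟩ ⟨hc, -⟩
    exact ⟨⟨_, _, _, rfl, fun h => hc h.symm⟩, by simp⟩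

open Classical in
theorem degree_extension_right (b : Fin r) :
    (Fintype.card Ω * s).choose 2 ≤ (extension KE S s r).degree (.inr (.inr b)) := by
  let F : Finset (Finset (Ω × Fin s)) := Finset.powersetCard 2 Finset.univ
  have hF : (F : Set (Finset (Ω × Fin s))).ncard = (Fintype.card Ω * s).choose 2 := by
    simp [F, Set.ncard_coe_finset]
  rw [← hF]
  refine card_le_degree _ _ _
    (fun p => insert (.inr (.inr b)) ((fun a => .inr (.inl a)) '' (p : Set (Ω × Fin s)))) ?_ ?_
  · intro p _ p' _ h
    ext a
    have := Set.ext_iff.1 h (.inr (.inl a))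
    simpa using this
  · intro p hp
    obtain ⟨a, a', hne, rfl⟩ := Finset.card_eq_two.1 (Finset.mem_powersetCard.1 hp).2
    exact ⟨⟨.inr (.inr b), .inr (.inl a), .inr (.inl a'), by simp [Set.image_insert_eq], hne⟩,
      by simp⟩

end Extension

end Hypergraph

/-! ### Degree estimates and the threshold -/

theorem exists_minDegree_eq {α : Type*} (H : Hypergraph α) (h : H.vertexSet.Nonempty) :
    ∃ v : H.vertexSet, H.minDegree = H.degree v := by
  have := h.to_subtype
  obtain ⟨v, hv⟩ := Nat.sInf_mem (Set.range_nonempty fun v : H.vertexSet => H.degree (v : α))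
  exact ⟨v, hv.symm⟩

/-- The set of which the chromatic threshold is the infimum contains `2`. -/
theorem two_mem_threshold_set (𝓕 : Set (UniformHypergraph 3)) :
    (2 : ℝ) ∈ {c : ℝ | 0 ≤ c ∧ ∃ M : ℕ, ∀ H ∈ 𝓕,
      c * (H.graph.vertexSet.ncard.choose (3 - 1) : ℝ) ≤ (H.graph.minDegree : ℝ) →
        H.graph.chromaticNumber ≤ (M : ℕ∞)} := by
  refine ⟨by norm_num, 1, fun H _ h => Hypergraph.Colorable.chromaticNumber_le ?_⟩
  refine ⟨fun _ => 0, fun e he => ?_⟩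
  -- No degree exceeds the number of pairs of vertices, so a hypergraph with an edge cannot meet the
  -- bound with c = 2.
  exfalso
  have hfin := H.finite_vertexSet
  set V := H.graph.vertexSet with hV
  have he3 : e.ncard = 3 := by simpa [Set.ncard] using congrArg ENat.toNat (H.encard_edge e he)
  have heV : e ⊆ V := H.graph.subset_vertexSet_of_mem_edgeSet' he
  have hV3 : 3 ≤ V.ncard := he3.symm.trans_le (Set.ncard_le_ncard heV hfin)
  obtain ⟨⟨v, hv⟩, hdeg⟩ := exists_minDegree_eq H.graph
    (Set.nonempty_of_ncard_ne_zero (s := V) (by omega))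
  have hle : H.graph.degree v ≤ V.ncard.choose 2 := by
    rw [← Set.ncard_powerset_ncard hfin]
    refine Set.ncard_le_ncard_of_injOn (fun e => e \ {v}) ?_ ?_
      (hfin.finite_subsets.subset fun t ht => ht.1)
    · rintro e' ⟨he', hve'⟩
      have h3 : e'.ncard = 3 := by
        simpa [Set.ncard] using congrArg ENat.toNat (H.encard_edge e' he')
      refine ⟨Set.sdiff_subset.trans (H.graph.subset_vertexSet_of_mem_edgeSet' he'), ?_⟩
      rw [Set.ncard_sdiff_singleton_of_mem hve', h3]
    · rintro e₁ ⟨-, h₁⟩ e₂ ⟨-, h₂⟩ h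
      rw [← Set.insert_sdiff_self_of_mem h₁, ← Set.insert_sdiff_self_of_mem h₂]
      exact congrArg (insert v) h
  have hpos : 0 < V.ncard.choose 2 := Nat.choose_pos (by omega)
  have h' : 2 * V.ncard.choose 2 ≤ H.graph.minDegree := by exact_mod_cast h
  rw [hdeg] at h'
  simp only at h'
  omega

open Hypergraph in
/-- The extension of the shift hypergraph as a uniform hypergraph. -/
noncomputable def shiftExtension (k n s r : ℕ) : UniformHypergraph 3 where
  carrier := ExtVertex (IncTuple k n) (Equiv.Perm (Fin n)) s r
  graph := extension IncTuple.ShiftEdge IncTuple.argmaxSet s r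
  finite_vertexSet := Set.toFinite _
  encard_edge := fun _ he => encard_extension_edge he

theorem shiftExtension_mem_freeFamily {q n s r : ℕ} (hq : 0 < q) :
    shiftExtension (3 * q + 1) n s r ∈ freeFamily Hypergraph.T5 3 := by
  obtain ⟨q, rfl⟩ := Nat.exists_eq_succ_of_ne_zero hq.ne'
  refine Hypergraph.extension_T5_free ?_ ?_ ?_ ?_
  · rintro u v w ⟨x, hx⟩
    exact ⟨x, by rw [← hx, Set.insert_comm]⟩
  · rintro u v w ⟨x, hx⟩
    exact ⟨x, by rw [← hx, Set.pair_comm]⟩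
  · exact fun u v w h ω => h.argmaxSet_inter ω
  · intro A B C D E hnd h h1 h2 h3
    simp only [List.nodup_cons, List.mem_cons, List.not_mem_nil, or_false, not_or] at hnd
    obtain ⟨⟨hAB, hAC, hAD, hAE⟩, ⟨hBC, hBD, hBE⟩, ⟨hCD, hCE⟩, hDE, -⟩ := hnd
    exact IncTuple.shiftEdge_T5_free (k := 3 * q + 1) hAB hAC hBC hAD hAE hBD hBE hCD hCE hDE
      h h1 h2 h3

theorem exists_chromaticNumber_shiftExtension_gt {k : ℕ} (hk : 0 < k) (M : ℕ) :
    ∃ n : ℕ, ∀ s r, ¬ (shiftExtension k n s r).graph.chromaticNumber ≤ M := by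
  obtain ⟨n, hn⟩ := IncTuple.exists_shiftEdge_monochromatic k M
  refine ⟨n, fun s r h => Hypergraph.not_colorable_extension (fun c => ?_)
    (Hypergraph.colorable_of_chromaticNumber_le h)⟩
  obtain ⟨u, v, w, h, huv, hvw⟩ := hn c
  obtain ⟨h1, h2, h3⟩ := h.ne hk
  exact ⟨u, v, w, h1, h2, h3, h, huv, hvw⟩

/-- Every degree of the extension with weights `4 : 3` is at least
`(8 - 8 / (3 * q + 1)) * T ^ 2`, where `T` is a seventh of the number of new vertices. -/
theorem le_minDegree_shiftExtension {q n t : ℕ} (hq : 0 < q) (ht : 3 * q + 1 ≤ t) :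
    (8 - 8 / (3 * q + 1 : ℝ)) * ((n.factorial * t : ℕ) : ℝ) ^ 2 ≤
      (shiftExtension (3 * q + 1) n (4 * t) (3 * (n.factorial * t))).graph.minDegree := by
  obtain ⟨⟨v, hv'⟩, hv⟩ := exists_minDegree_eq
    (shiftExtension (3 * q + 1) n (4 * t) (3 * (n.factorial * t))).graph
    ⟨.inr (.inl (1, ⟨0, by omega⟩)), Set.mem_univ _⟩
  rw [hv]
  suffices h : ∀ v : Hypergraph.ExtVertex (IncTuple (3 * q + 1) n) (Equiv.Perm (Fin n)) (4 * t)
      (3 * (n.factorial * t)), (8 - 8 / (3 * q + 1 : ℝ)) * ((n.factorial * t : ℕ) : ℝ) ^ 2 ≤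
      ((Hypergraph.extension IncTuple.ShiftEdge IncTuple.argmaxSet (4 * t)
        (3 * (n.factorial * t))).degree v : ℝ) from h v
  clear hv hv' v
  set T := n.factorial * t with hT
  have hTt : t ≤ T := Nat.le_mul_of_pos_left _ n.factorial_pos
  have hcard : Fintype.card (Equiv.Perm (Fin n)) * (4 * t) = 4 * T := by
    rw [Fintype.card_perm, Fintype.card_fin, hT]; ring
  clear_value T
  have hT1 : (3 * q + 1 : ℝ) ≤ T := by exact_mod_cast ht.trans hTt
  have hq' : (1 : ℝ) ≤ q := by exact_mod_cast hq
  have hk : (8 - 8 / (3 * q + 1 : ℝ)) * (3 * q + 1) = 24 * q := by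
    field_simp; ring
  have hpos : (0 : ℝ) < 3 * q + 1 := by positivity
  set θ := 8 - 8 / (3 * q + 1 : ℝ)
  have hθ8 : θ ≤ 8 := by
    have : (0 : ℝ) ≤ 8 / (3 * q + 1 : ℝ) := by positivity
    simp only [θ]; linarith
  rintro (u | a | b)
  · have hd := Hypergraph.degree_extension_core (KE := IncTuple.ShiftEdge)
      (S := IncTuple.argmaxSet) (s := 4 * t) (r := 3 * T) u
    have hS := IncTuple.card_argmaxSet u
    refine le_trans ?_ (Nat.cast_le.2 hd)
    refine le_of_mul_le_mul_right ?_ hpos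
    have e : (((IncTuple.argmaxSet u).ncard * (4 * t) * (3 * T) : ℕ) : ℝ) * (3 * q + 1) =
        (((3 * q + 1) * (IncTuple.argmaxSet u).ncard : ℕ) : ℝ) * (4 * t) * (3 * T) := by
      push_cast; ring
    have e' : ((Fintype.card (Equiv.Perm (Fin n)) * (4 * t) : ℕ) : ℝ) = 4 * T := by
      rw [hcard]; push_cast; ring
    rw [e, hS]
    push_cast at e' ⊢
    have : θ * (T : ℝ) ^ 2 * (3 * q + 1) = 24 * q * T ^ 2 := by rw [← hk]; ring
    rw [this]
    apply le_of_eq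
    linear_combination (-(6 * q * T : ℝ)) * e'
  · have hd := Hypergraph.degree_extension_left
      (KE := IncTuple.ShiftEdge (k := 3 * q + 1) (n := n)) (S := IncTuple.argmaxSet) (s := 4 * t) (r := 3 * T) a
    refine le_trans ?_ (Nat.cast_le.2 hd)
    rw [hcard, Nat.cast_mul, Nat.cast_sub (by omega)]
    push_cast
    nlinarith
  · have hd := Hypergraph.degree_extension_right
      (KE := IncTuple.ShiftEdge (k := 3 * q + 1) (n := n)) (S := IncTuple.argmaxSet) (s := 4 * t) (r := 3 * T) b
    refine le_trans ?_ (Nat.cast_le.2 hd)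
    rw [hcard, Nat.cast_choose_two]
    push_cast
    -- The pairs inside X number 8T² - 2T; the slack 8/(3q + 1) in θ absorbs the term 2T because T ≥
    -- 3q + 1.
    have h1 : θ * (3 * q + 1) * T ≤ (8 * T - 2) * (3 * q + 1) := by rw [hk]; nlinarith
    have h2 : θ * T ≤ 8 * T - 2 := le_of_mul_le_mul_right (by linarith) hpos
    nlinarith

theorem exists_small_density {c : ℝ} (hc : c < 16 / 49) :
    ∃ q : ℕ, 0 < q ∧ 49 * c < 2 * (8 - 8 / (3 * q + 1 : ℝ)) := by
  obtain ⟨q, hq⟩ := exists_nat_gt (16 / (16 - 49 * c))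
  have hpos : 0 < 16 - 49 * c := by linarith
  have hq0 : (0 : ℝ) < q := lt_trans (by positivity) hq
  refine ⟨q, by exact_mod_cast hq0, ?_⟩
  rw [div_lt_iff₀ hpos] at hq
  have : 8 / (3 * q + 1 : ℝ) < (16 - 49 * c) / 2 := by
    rw [div_lt_iff₀ (by positivity)]
    nlinarith
  linarith

/-- The κ core vertices change the number of pairs only by a term linear in T. -/
theorem exists_choose_two_le {c θ : ℝ} (hc : 0 ≤ c) (h : 49 * c < 2 * θ) (κ : ℕ) :
    ∃ t₀ : ℕ, ∀ T : ℕ, t₀ ≤ T → c * ((κ + 7 * T).choose 2 : ℝ) ≤ θ * (T : ℝ) ^ 2 := by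
  obtain ⟨t₀, ht₀⟩ := exists_nat_gt ((14 * κ + κ ^ 2) * c / (2 * θ - 49 * c))
  refine ⟨t₀ + 1, fun T hT => ?_⟩
  have hT1 : (1 : ℝ) ≤ T := by exact_mod_cast (by omega : 1 ≤ T)
  have hT0 : (t₀ : ℝ) ≤ T := by exact_mod_cast (by omega : t₀ ≤ T)
  have h1 := ht₀.trans_le hT0
  rw [div_lt_iff₀ (by linarith)] at h1
  have h2 : ((κ + 7 * T).choose 2 : ℝ) ≤ (49 * T ^ 2 + (14 * κ + κ ^ 2) * T) / 2 := by
    rw [Nat.cast_choose_two]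
    push_cast
    have : (0 : ℝ) ≤ κ ^ 2 := by positivity
    have : (0 : ℝ) ≤ κ := by positivity
    nlinarith
  calc c * ((κ + 7 * T).choose 2 : ℝ) ≤ c * ((49 * T ^ 2 + (14 * κ + κ ^ 2) * T) / 2) := by gcongr
    _ = (49 * c * T ^ 2 + ((14 * κ + κ ^ 2) * c) * T) / 2 := by ring
    _ ≤ (49 * c * T ^ 2 + (T * (2 * θ - 49 * c)) * T) / 2 := by gcongr
    _ = θ * (T : ℝ) ^ 2 := by ring

theorem mainTheorem11 :
    (16 / 49 : ℝ) ≤ chromaticThreshold (freeFamily Hypergraph.T5 3) := by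
  refine le_csInf ⟨2, two_mem_threshold_set _⟩ ?_
  rintro c ⟨hc0, M, hM⟩
  by_contra! hc
  obtain ⟨q, hq, hqc⟩ := exists_small_density hc
  obtain ⟨n, hn⟩ := exists_chromaticNumber_shiftExtension_gt (k := 3 * q + 1) (by omega) M
  obtain ⟨t₀, ht₀⟩ := exists_choose_two_le hc0 hqc (Fintype.card (IncTuple (3 * q + 1) n))
  -- The parameter t is chosen last: q depends on c, n on q and M, and t₀ on the size of the core.
  set t := t₀ + (3 * q + 1) with ht
  have htT : t ≤ n.factorial * t := Nat.le_mul_of_pos_left _ n.factorial_pos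
  refine hn (4 * t) (3 * (n.factorial * t)) (hM _ (shiftExtension_mem_freeFamily hq) ?_)
  refine le_trans ?_ (le_minDegree_shiftExtension hq (by omega))
  have hcard : (shiftExtension (3 * q + 1) n (4 * t)
      (3 * (n.factorial * t))).graph.vertexSet.ncard =
        Fintype.card (IncTuple (3 * q + 1) n) + 7 * (n.factorial * t) := by
    refine (Set.ncard_univ (Hypergraph.ExtVertex (IncTuple (3 * q + 1) n)
      (Equiv.Perm (Fin n)) (4 * t) (3 * (n.factorial * t)))).trans ?_
    rw [Nat.card_eq_fintype_card]
    simp only [Fintype.card_sum, Fintype.card_prod, Fintype.card_perm, Fintype.card_fin]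
    ring
  rw [hcard]
  exact ht₀ _ (by omega)
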